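/- **Setting.** Let $\mathcal S,\widehat{\mathcal S}_1,\widehat{\mathcal S}_2$ be finite sets, $S$ a random variable on $\mathcal S$ with law $P_S$, $M_1,M_2\ge 1$ integers, $\mathcal X_i=\mathcal Y_i=\{1,\dots,M_i\}$, $d_i:\mathcal S\times\widehat{\mathcal S}_i\to[0,\infty)$ distortion measures and $D_i\in[0,\infty)$, $i=1,2$. All channels are noiseless: $P_{Y_i|X_i}(y_i|x_i)=\mathbb I\{y_i=x_i\}$. A successive refinement code consists of encoders $f_i:\mathcal S\to\mathcal X_i$ and decoders $g_1:\mathcal Y_1\to\widehat{\mathcal S}_1$, $g_2:\mathcal Y_1\times\mathcal Y_2\to\widehat{\mathcal S}_2$, with $X_i=f_i(S)$, $\widehat S_1=g_1(Y_1)$, $\widehat S_2=g_2(Y_1,Y_2)$; a randomized code has kernels $Q_{X_1|S},Q_{X_2|S},Q_{\widehat S_1|Y_1},Q_{\widehat S_2|Y_1Y_2}$ instead, and the joint law $P_SQ_{X_1|S}Q_{X_2|S}P_{Y_1|X_1}P_{Y_2|X_2}Q_{\widehat S_1|Y_1}Q_{\widehat S_2|Y_1Y_2}$. Logarithms are natural.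 Let $R^{(i)}(D)=\inf\{I(S;\widehat S_i): P_{\widehat S_i|S},\ \mathbb E[d_i(S,\widehat S_i)]\le D\}$. Assume that this infimum is attained at $D=D_i$, fix an optimal kernel with output law $P_{\widehat S_i^*}$, and assume that $R^{(i)}$ is differentiable at $D_i$; put $\lambda_i^*=-R^{(i)\prime}(D_i)$ and $$j_{\widehat S_i}(s,D_i)=\log\frac1{\mathbb E[\exp(\lambda_i^*D_i-\lambda_i^*d_i(s,\widehat S_i^*))]} .$$ Assume that $(S,D_1,D_2)$ is successively refinable: the set of pairs $(R_1,R_2)\in[0,\infty)^2$ for which there is a kernel $P_{\widehat S_1\widehat S_2|S}$ with $\mathbb E[d_i(S,\widehat S_i)]\le D_i$ $(i=1,2)$, $I(S;\widehat S_1)\le R_1$ and $I(S;\widehat S_1,\widehat S_2)\le R_1+R_2$, equals $\{(R_1,R_2)\in[0,\infty)^2: R_1\ge R^{(1)}(D_1),\ R_1+R_2\ge R^{(2)}(D_2)\}$. **The program DPSR** (the dual of a lift-and-project linear programming relaxation of the coding problem). Put $\Pi=P_S(s)\,\mathbb I\{y_1=x_1\}\mathbb I\{y_2=x_2\}\mathbb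 I\{d_1(s,\widehat s_1)>D_1\text{ or }d_2(s,\widehat s_2)>D_2\}$. Over all real-valued functions $\eta^1(s)$, $\eta^2(y_1)$, $\eta^3(y_1,y_2)$, $\eta^4(s)$, $\lambda^a(s,x_2,y_1,y_2,\widehat s_1,\widehat s_2)$, $\lambda^b(s,x_1,y_1,y_2,\widehat s_1,\widehat s_2)$, $\lambda^c(s,x_1,x_2,y_1,y_2,\widehat s_1)$, $\mu(s,x_1,x_2,y_1)$, $\delta^1(x_2,s)$, $\delta^2(s,\widehat s_2,y_1,y_2)$, $\delta^3(s,\widehat s_1,y_1)$, $\theta(x_1,s,y_1,\widehat s_2,y_2)$, $\gamma(x_2,s,\widehat s_1,y_1,y_2)$, maximize $$\sum_s\eta^1(s)+\sum_{y_1}\eta^2(y_1)+\sum_{y_1,y_2}\eta^3(y_1,y_2)$$ subject, for all values of the free indices, to $\eta^1\le\delta^1$; $\eta^2\le\sum_s\delta^3$; $\eta^3\le\sum_s\delta^2$; $\lambda^a+\lambda^b+\lambda^c\le\Pi$; $\mu\le\sum_{y_2}\lambda^c$; $\delta^1\le\sum_{y_1}\mu$; $\delta^2\le\theta$; $\delta^3\le\sum_{y_2}\gamma$;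 $\theta\le\lambda^b$; $\gamma\le\lambda^a$; $\eta^4\le0$. Let $\mathrm{OPT}(\mathrm{DPSR})$ be the supremum of the objective. **Theorem.** For every code, deterministic or randomized, $$\mathbb P[d_1(S,\widehat S_1)>D_1\text{ or }d_2(S,\widehat S_2)>D_2]\ \ge\ \mathrm{OPT}(\mathrm{DPSR})\ \ge\ \sup_{\gamma_1,\gamma_2\in\mathbb R}\bigl\{B(\gamma_1,\gamma_2)+\Delta(\gamma_1,\gamma_2)\bigr\},$$ where $$B(\gamma_1,\gamma_2)=\mathbb P\bigl[j_{\widehat S_1}(S,D_1)\ge\log M_1+\gamma_1\text{ or }j_{\widehat S_2}(S,D_2)\ge\log (M_1M_2)+\gamma_2\bigr]-e^{-\gamma_1}-e^{-\gamma_2},$$ $$\Delta(\gamma_1,\gamma_2)=\sum_s\frac{P_S(s)}{2M_1}\Bigl(e^{j_{\widehat S_1}(s,D_1)-\gamma_1}+\frac1{M_2}e^{j_{\widehat S_2}(s,D_2)-\gamma_2}\Bigr)\mathbb I\bigl\{j_{\widehat S_1}(s,D_1)<\log M_1+\gamma_1,\ j_{\widehat S_2}(s,D_2)<\log (M_1M_2)+\gamma_2\bigr\}.$$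 Moreover, for all $\gamma_1,\gamma_2\in\mathbb R$ there is a feasible point of DPSR with objective value $B(\gamma_1,\gamma_2)+\Delta(\gamma_1,\gamma_2)$, and $\Delta(\gamma_1,\gamma_2)\ge0$, so that the bound is at least as large as $\sup_{\gamma_1,\gamma_2}B(\gamma_1,\gamma_2)$, the bound of Zhou et al. -/

import Mathlib

/-! # Finite-alphabet rate-distortion theory

A law on a finite alphabet `S` is a point of `stdSimplex ℝ S`; logarithms are natural. -/

namespace SuccRef

/-- `W` is a conditional distribution (stochastic kernel) from `A` to `B`; `W a b` is `W(b|a)`. -/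
def IsKernel {A B : Type*} [Fintype B] (W : A → B → ℝ) : Prop :=
  ∀ a, W a ∈ stdSimplex ℝ B

/-- The output marginal `∑ a, P(a) W(b|a)`. -/
noncomputable def outputLaw {A B : Type*} [Fintype A] (P : A → ℝ) (W : A → B → ℝ) (b : B) : ℝ :=
  ∑ a, P a * W a b

/-- Mutual information `I(A;B)` (in nats) under the joint law `P(a) W(b|a)`.  If the output law
vanishes at `b`, all the weights `P(a) W(b|a)` vanish, so such terms contribute `0`. -/
noncomputable def mutualInfo {A B : Type*} [Fintype A] [Fintype B]
    (P : A → ℝ) (W : A → B → ℝ) : ℝ :=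
  ∑ a, ∑ b, P a * W a b * Real.log (W a b / outputLaw P W b)

/-- The expected distortion `E[d(A,B)]` under the joint law `P(a) W(b|a)`. -/
noncomputable def expDistortion {A B : Type*} [Fintype A] [Fintype B]
    (P : A → ℝ) (d : A → B → ℝ) (W : A → B → ℝ) : ℝ :=
  ∑ a, ∑ b, P a * W a b * d a b

/-- The rate-distortion function
`R(D) = inf { I(S;T) : P_{T|S} a kernel with E[d(S,T)] ≤ D }`. -/
noncomputable def rateDistortion {S T : Type*} [Fintype S] [Fintype T]
    (P : S → ℝ) (d : S → T → ℝ) (D : ℝ) : ℝ :=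
  sInf {r | ∃ W : S → T → ℝ, IsKernel W ∧ expDistortion P d W ≤ D ∧ r = mutualInfo P W}

/-- `W` achieves the infimum in the rate-distortion function at the level `D`
(in particular the level `D` is feasible). -/
def IsOptimalTestChannel {S T : Type*} [Fintype S] [Fintype T]
    (P : S → ℝ) (d : S → T → ℝ) (D : ℝ) (W : S → T → ℝ) : Prop :=
  IsKernel W ∧ expDistortion P d W ≤ D ∧ mutualInfo P W = rateDistortion P d D

/-- The `D`-tilted information
`log (1 / E[exp (λ D - λ d(s,T*))])`, where `λ = - R'(D)` and `T*` has the output law of `W`;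
used with a `W` that achieves the infimum in `R(D)` and with `R` differentiable at `D`.
(The real-valued `rateDistortion` is `0` at infeasible levels; so it is differentiable at the least
feasible level only if `R` vanishes there and hence at every feasible level, and then `λ = 0`.) -/
noncomputable def tiltedInfo {S T : Type*} [Fintype S] [Fintype T]
    (P : S → ℝ) (d : S → T → ℝ) (D : ℝ) (W : S → T → ℝ) (s : S) : ℝ :=
  Real.log (1 / ∑ t, outputLaw P W t *
    Real.exp (-deriv (rateDistortion P d) D * D - -deriv (rateDistortion P d) D * d s t))

/-- The successive refinement rate region: nonnegative pairs `(R₁, R₂)` such that some kernel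
`P_{T₁ T₂ | S}` meets both distortion constraints and has `I(S;T₁) ≤ R₁`,
`I(S;T₁,T₂) ≤ R₁ + R₂`. -/
def rateRegion {S T₁ T₂ : Type*} [Fintype S] [Fintype T₁] [Fintype T₂]
    (P : S → ℝ) (d₁ : S → T₁ → ℝ) (d₂ : S → T₂ → ℝ) (D₁ D₂ : ℝ) : Set (ℝ × ℝ) :=
  {r | 0 ≤ r.1 ∧ 0 ≤ r.2 ∧ ∃ W : S → T₁ × T₂ → ℝ, IsKernel W ∧
    expDistortion P (fun s t => d₁ s t.1) W ≤ D₁ ∧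
    expDistortion P (fun s t => d₂ s t.2) W ≤ D₂ ∧
    mutualInfo P (fun s t₁ => ∑ t₂, W s (t₁, t₂)) ≤ r.1 ∧
    mutualInfo P W ≤ r.1 + r.2}

/-- Successive refinability at `(D₁, D₂)`: the rate region is limited only by the two individual
rate-distortion functions, `R₁ ≥ R⁽¹⁾(D₁)` and `R₁ + R₂ ≥ R⁽²⁾(D₂)`. -/
def IsSuccessivelyRefinable {S T₁ T₂ : Type*} [Fintype S] [Fintype T₁] [Fintype T₂]
    (P : S → ℝ) (d₁ : S → T₁ → ℝ) (d₂ : S → T₂ → ℝ) (D₁ D₂ : ℝ) : Prop :=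
  rateRegion P d₁ d₂ D₁ D₂ =
    {r | 0 ≤ r.1 ∧ 0 ≤ r.2 ∧ rateDistortion P d₁ D₁ ≤ r.1 ∧ rateDistortion P d₂ D₂ ≤ r.1 + r.2}

/-! ## Codes -/

/-- The noiseless channel `P_{Y|X}(y|x) = 1{y = x}`. -/
def noiseless {M : ℕ} (y x : Fin M) : ℝ := if y = x then 1 else 0

/-- The joint excess distortion loss `1{d₁(s,t₁) > D₁ or d₂(s,t₂) > D₂}`. -/
noncomputable def excessLoss {S T₁ T₂ : Type*} (d₁ : S → T₁ → ℝ) (d₂ : S → T₂ → ℝ) (D₁ D₂ : ℝ)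
    (s : S) (t₁ : T₁) (t₂ : T₂) : ℝ :=
  if D₁ < d₁ s t₁ ∨ D₂ < d₂ s t₂ then 1 else 0

/-- A deterministic code: two encoders of the source and two decoders, the first seeing only the
first message and the second seeing both. -/
structure Code (S T₁ T₂ : Type*) (M₁ M₂ : ℕ) where
  f₁ : S → Fin M₁
  f₂ : S → Fin M₂
  g₁ : Fin M₁ → T₁
  g₂ : Fin M₁ → Fin M₂ → T₂

/-- The joint excess distortion probability of a deterministic code over noiseless channels. -/
noncomputable def Code.excessProb {S T₁ T₂ : Type*} [Fintype S] {M₁ M₂ : ℕ}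
    (c : Code S T₁ T₂ M₁ M₂) (P : S → ℝ) (d₁ : S → T₁ → ℝ) (d₂ : S → T₂ → ℝ) (D₁ D₂ : ℝ) : ℝ :=
  ∑ s, P s * excessLoss d₁ d₂ D₁ D₂ s (c.g₁ (c.f₁ s)) (c.g₂ (c.f₁ s) (c.f₂ s))

/-- A randomized code: the encoders and decoders are kernels. -/
structure RandCode (S T₁ T₂ : Type*) [Fintype T₁] [Fintype T₂] (M₁ M₂ : ℕ) where
  qX₁ : S → Fin M₁ → ℝ
  qX₂ : S → Fin M₂ → ℝ
  qT₁ : Fin M₁ → T₁ → ℝ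
  qT₂ : Fin M₁ × Fin M₂ → T₂ → ℝ
  qX₁_kernel : IsKernel qX₁
  qX₂_kernel : IsKernel qX₂
  qT₁_kernel : IsKernel qT₁
  qT₂_kernel : IsKernel qT₂

/-- The joint excess distortion probability `∑_z κ(z) Q(z)` of a randomized code, where
`Q = P_S Q_{X₁|S} Q_{X₂|S} P_{Y₁|X₁} P_{Y₂|X₂} Q_{T₁|Y₁} Q_{T₂|Y₁Y₂}`. -/
noncomputable def RandCode.excessProb {S T₁ T₂ : Type*} [Fintype S] [Fintype T₁] [Fintype T₂]
    {M₁ M₂ : ℕ} (c : RandCode S T₁ T₂ M₁ M₂)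
    (P : S → ℝ) (d₁ : S → T₁ → ℝ) (d₂ : S → T₂ → ℝ) (D₁ D₂ : ℝ) : ℝ :=
  ∑ s, ∑ x₁, ∑ x₂, ∑ y₁, ∑ y₂, ∑ t₁, ∑ t₂,
    excessLoss d₁ d₂ D₁ D₂ s t₁ t₂ *
      (P s * c.qX₁ s x₁ * c.qX₂ s x₂ * noiseless y₁ x₁ * noiseless y₂ x₂ *
        c.qT₁ y₁ t₁ * c.qT₂ (y₁, y₂) t₂)

/-! ## The dual linear program -/

/-- The variables of the dual program, all real and unrestricted in sign. -/
structure DualVars (S T₁ T₂ : Type*) (M₁ M₂ : ℕ) where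
  η₁ : S → ℝ
  η₂ : Fin M₁ → ℝ
  η₃ : Fin M₁ → Fin M₂ → ℝ
  η₄ : S → ℝ
  /-- `lamA s x₂ y₁ y₂ t₁ t₂` -/
  lamA : S → Fin M₂ → Fin M₁ → Fin M₂ → T₁ → T₂ → ℝ
  /-- `lamB s x₁ y₁ y₂ t₁ t₂` -/
  lamB : S → Fin M₁ → Fin M₁ → Fin M₂ → T₁ → T₂ → ℝ
  /-- `lamC s x₁ x₂ y₁ y₂ t₁` -/
  lamC : S → Fin M₁ → Fin M₂ → Fin M₁ → Fin M₂ → T₁ → ℝ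
  /-- `μ s x₁ x₂ y₁` -/
  μ : S → Fin M₁ → Fin M₂ → Fin M₁ → ℝ
  /-- `δ₁ x₂ s` -/
  δ₁ : Fin M₂ → S → ℝ
  /-- `δ₂ s t₂ y₁ y₂` -/
  δ₂ : S → T₂ → Fin M₁ → Fin M₂ → ℝ
  /-- `δ₃ s t₁ y₁` -/
  δ₃ : S → T₁ → Fin M₁ → ℝ
  /-- `θ x₁ s y₁ t₂ y₂` -/
  θ : Fin M₁ → S → Fin M₁ → T₂ → Fin M₂ → ℝ
  /-- `γ x₂ s t₁ y₁ y₂` -/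
  γ : Fin M₂ → S → T₁ → Fin M₁ → Fin M₂ → ℝ

/-- The dual objective. -/
noncomputable def DualVars.objective {S T₁ T₂ : Type*} [Fintype S] {M₁ M₂ : ℕ}
    (F : DualVars S T₁ T₂ M₁ M₂) : ℝ :=
  (∑ s, F.η₁ s) + (∑ y₁, F.η₂ y₁) + (∑ y₁, ∑ y₂, F.η₃ y₁ y₂)

/-- The constraints of the dual program.  Each of them belongs to one family of variables of the
primal linear program. -/
structure DualVars.Feasible {S T₁ T₂ : Type*} [Fintype S] {M₁ M₂ : ℕ}
    (F : DualVars S T₁ T₂ M₁ M₂)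
    (P : S → ℝ) (d₁ : S → T₁ → ℝ) (d₂ : S → T₂ → ℝ) (D₁ D₂ : ℝ) : Prop where
  c1 : ∀ s x₂, F.η₁ s - F.δ₁ x₂ s ≤ 0
  c2 : ∀ y₁ t₁, F.η₂ y₁ - ∑ s, F.δ₃ s t₁ y₁ ≤ 0
  c3 : ∀ y₁ y₂ t₂, F.η₃ y₁ y₂ - ∑ s, F.δ₂ s t₂ y₁ y₂ ≤ 0
  c4 : ∀ s x₁ x₂ y₁ y₂ t₁ t₂,
    F.lamA s x₂ y₁ y₂ t₁ t₂ + F.lamB s x₁ y₁ y₂ t₁ t₂ + F.lamC s x₁ x₂ y₁ y₂ t₁ ≤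
      P s * noiseless y₁ x₁ * noiseless y₂ x₂ * excessLoss d₁ d₂ D₁ D₂ s t₁ t₂
  c5 : ∀ s x₁ x₂ y₁ t₁, -(∑ y₂, F.lamC s x₁ x₂ y₁ y₂ t₁) + F.μ s x₁ x₂ y₁ ≤ 0
  c6 : ∀ s x₁ x₂, -(∑ y₁, F.μ s x₁ x₂ y₁) + F.δ₁ x₂ s ≤ 0
  c7 : ∀ s x₁ y₁ y₂ t₂, -F.θ x₁ s y₁ t₂ y₂ + F.δ₂ s t₂ y₁ y₂ ≤ 0
  c8 : ∀ s x₂ y₁ t₁, -(∑ y₂, F.γ x₂ s t₁ y₁ y₂) + F.δ₃ s t₁ y₁ ≤ 0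
  c9 : ∀ s x₁ y₁ y₂ t₁ t₂, -F.lamB s x₁ y₁ y₂ t₁ t₂ + F.θ x₁ s y₁ t₂ y₂ ≤ 0
  c10 : ∀ s x₂ y₁ y₂ t₁ t₂, -F.lamA s x₂ y₁ y₂ t₁ t₂ + F.γ x₂ s t₁ y₁ y₂ ≤ 0
  c11 : ∀ s, F.η₄ s ≤ 0

/-- The optimal value of the dual program, as a supremum in the extended reals. -/
noncomputable def optDPSR {S T₁ T₂ : Type*} [Fintype S] (M₁ M₂ : ℕ)
    (P : S → ℝ) (d₁ : S → T₁ → ℝ) (d₂ : S → T₂ → ℝ) (D₁ D₂ : ℝ) : EReal :=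
  ⨆ (F : DualVars S T₁ T₂ M₁ M₂) (_ : F.Feasible P d₁ d₂ D₁ D₂), ((F.objective : ℝ) : EReal)

/-! ## The bound

Here `j₁ j₂ : S → ℝ` are the two tilted informations. -/

/-- The tilted-information converse
`P[j₁ ≥ log M₁ + γ₁ or j₂ ≥ log (M₁ M₂) + γ₂] - exp(-γ₁) - exp(-γ₂)`. -/
noncomputable def baseBound {S : Type*} [Fintype S] (M₁ M₂ : ℕ) (P j₁ j₂ : S → ℝ)
    (γ₁ γ₂ : ℝ) : ℝ :=
  (∑ s, if Real.log M₁ + γ₁ ≤ j₁ s ∨ Real.log (M₁ * M₂) + γ₂ ≤ j₂ s then P s else 0)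
    - Real.exp (-γ₁) - Real.exp (-γ₂)

/-- The additional term
`∑ s, P(s)/(2 M₁) (exp (j₁(s) - γ₁) + exp (j₂(s) - γ₂) / M₂)
  1{j₁(s) < log M₁ + γ₁, j₂(s) < log (M₁ M₂) + γ₂}`. -/
noncomputable def improvement {S : Type*} [Fintype S] (M₁ M₂ : ℕ) (P j₁ j₂ : S → ℝ)
    (γ₁ γ₂ : ℝ) : ℝ :=
  ∑ s, P s / (2 * M₁) *
    ((Real.exp (j₁ s - γ₁) + 1 / M₂ * Real.exp (j₂ s - γ₂)) *
      if j₁ s < Real.log M₁ + γ₁ ∧ j₂ s < Real.log (M₁ * M₂) + γ₂ then 1 else 0)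

end SuccRef

/-! Two independent halves meet at the dual program. For weak duality, the loss constraint `c4` is
averaged over the kernels of a code, and the three multipliers `lamA`, `lamB`, `lamC` are bounded
below by the three parts of the objective.

For the lower bound on the optimum, the one fact needed from rate-distortion theory is `∑ s, P s *
exp (j s) * 1{d s t ≤ D} ≤ 1` for every letter `t`. Put `a = exp (j₁ - γ₁) / M₁`, `b = exp (j₂ - γ₂)
/ (M₁ M₂)` and let `v ≤ min 1 (a + b)`. Then `v - a 1{d₁ ≤ D₁} - b 1{d₂ ≤ D₂}` never exceeds the
loss: if both reproductions are good, `v ≤ a + b`; otherwise the loss is `1 ≥ v`. The fact bounds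
the `a`-penalty by `exp (-γ₁) / M₁` for each of the `M₁` messages and the `b`-penalty by `exp (-γ₂)
/ (M₁ M₂)` for each of the `M₁ M₂` pairs. Taking `v = 1` where `a ≥ 1` or `b ≥ 1` gives the base
bound; `v = (a + b) / 2` elsewhere gives the additional term.

The fact is a Kuhn-Tucker condition. Differentiability of `R` at `D` makes the optimal kernel
minimize `I + λ (E d - D)`. For an output law `Q`, a Gibbs kernel brings this Lagrangian down to `-E
log Z_Q` or lower, so no `Q` makes `E log Z_Q` larger than the optimal output law does. Moving mass
`ε` to one letter and differentiating at `0` gives the condition; where `d ≤ D` the Gibbs factor is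
at least `1`. -/

namespace SuccRef

/-! ### Mutual information of finite kernels. -/

section RateDistortion

variable {A B : Type*} [Fintype A] [Fintype B]

/-- A tangent-line bound for the perspective of `x log x`. -/
theorem mul_log_add_sub_le_mul_log_div {x y u : ℝ} (hx : 0 ≤ x) (hy : 0 ≤ y) (hu : 0 < u)
    (h : y = 0 → x = 0) : x * Real.log u + x - u * y ≤ x * Real.log (x / y) := by
  rcases hx.eq_or_lt with rfl | hx
  · simpa using mul_nonneg hu.le hy
  have hy : 0 < y := hy.lt_of_ne fun h0 => hx.ne' (h h0.symm)
  -- The bound `1 - 1/z ≤ log z` at `z = x / (u y)`; it is tight when `u = x / y`.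
  have h1 := Real.one_sub_inv_le_log_of_pos (div_pos hx (mul_pos hu hy))
  have h2 : Real.log (x / (u * y)) = Real.log (x / y) - Real.log u := by
    rw [← Real.log_div (by positivity) hu.ne']
    congr 1
    field_simp
  rw [h2] at h1
  have h3 := mul_le_mul_of_nonneg_left h1 hx.le
  have h4 : x * (1 - (x / (u * y))⁻¹) = x - u * y := by field_simp
  linarith

theorem IsKernel.nonneg {A B : Type*} [Fintype B] {W : A → B → ℝ} (hW : IsKernel W) (a : A)
    (b : B) : 0 ≤ W a b := (hW a).1 b

theorem IsKernel.sum_eq_one {A B : Type*} [Fintype B] {W : A → B → ℝ} (hW : IsKernel W) (a : A) :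
    ∑ b, W a b = 1 := (hW a).2

theorem IsKernel.convexComb {A B : Type*} [Fintype B] {W W' : A → B → ℝ} (hW : IsKernel W)
    (hW' : IsKernel W') {ε : ℝ} (h0 : 0 ≤ ε) (h1 : ε ≤ 1) :
    IsKernel fun a b => (1 - ε) * W a b + ε * W' a b := fun a =>
  convex_stdSimplex ℝ B (hW a) (hW' a) (sub_nonneg.2 h1) h0 (by ring)

theorem outputLaw_nonneg {P : A → ℝ} (hP : ∀ a, 0 ≤ P a) {W : A → B → ℝ} (hW : IsKernel W)
    (b : B) : 0 ≤ outputLaw P W b :=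
  Finset.sum_nonneg fun a _ => mul_nonneg (hP a) (hW.nonneg a b)

theorem sum_outputLaw {P : A → ℝ} (hP : P ∈ stdSimplex ℝ A) {W : A → B → ℝ} (hW : IsKernel W) :
    ∑ b, outputLaw P W b = 1 := by
  unfold outputLaw
  rw [Finset.sum_comm]
  simp_rw [← Finset.mul_sum, hW.sum_eq_one, mul_one]
  exact hP.2

/-- Absolute continuity on the support of `P`. It supplies the side condition of the tangent-line
bound; letters of probability zero only contribute zero terms. -/
theorem eq_zero_of_outputLaw_eq_zero {P : A → ℝ} (hP : ∀ a, 0 ≤ P a) {W : A → B → ℝ}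
    (hW : IsKernel W) {a : A} (ha : 0 < P a) {b : B} (h : outputLaw P W b = 0) : W a b = 0 := by
  have h1 := (Finset.sum_eq_zero_iff_of_nonneg
    (fun a _ => mul_nonneg (hP a) (hW.nonneg a b))).1 h a (Finset.mem_univ a)
  exact (mul_eq_zero.1 h1).resolve_left ha.ne'

omit [Fintype B] in
theorem outputLaw_convexComb (P : A → ℝ) (W W' : A → B → ℝ) (ε : ℝ) (b : B) :
    outputLaw P (fun a b => (1 - ε) * W a b + ε * W' a b) b =
      (1 - ε) * outputLaw P W b + ε * outputLaw P W' b := by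
  simp only [outputLaw, Finset.mul_sum, ← Finset.sum_add_distrib]
  exact Finset.sum_congr rfl fun a _ => by ring

theorem expDistortion_convexComb (P : A → ℝ) (d : A → B → ℝ) (W W' : A → B → ℝ) (ε : ℝ) :
    expDistortion P d (fun a b => (1 - ε) * W a b + ε * W' a b) =
      (1 - ε) * expDistortion P d W + ε * expDistortion P d W' := by
  simp only [expDistortion, Finset.mul_sum, ← Finset.sum_add_distrib]
  exact Finset.sum_congr rfl fun a _ => Finset.sum_congr rfl fun b _ => by ring

theorem sum_sum_mul_kernel {P : A → ℝ} (hP : P ∈ stdSimplex ℝ A) {W : A → B → ℝ}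
    (hW : IsKernel W) : ∑ a, ∑ b, P a * W a b = 1 := by
  simp_rw [← Finset.mul_sum, hW.sum_eq_one, mul_one]
  exact hP.2

theorem mutualInfo_nonneg {P : A → ℝ} (hP : P ∈ stdSimplex ℝ A) {W : A → B → ℝ}
    (hW : IsKernel W) : 0 ≤ mutualInfo P W := by
  have key : ∑ a, ∑ b, (P a * W a b - P a * outputLaw P W b) ≤ mutualInfo P W := by
    refine Finset.sum_le_sum fun a _ => Finset.sum_le_sum fun b _ => ?_
    rcases (hP.1 a).eq_or_lt with h | h
    · simp [← h]
    have h1 := mul_log_add_sub_le_mul_log_div (hW.nonneg a b) (outputLaw_nonneg hP.1 hW b)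
      one_pos (eq_zero_of_outputLaw_eq_zero hP.1 hW h)
    simp only [Real.log_one, mul_zero, zero_add, one_mul] at h1
    have h2 := mul_le_mul_of_nonneg_left h1 h.le
    linarith
  simp only [Finset.sum_sub_distrib] at key
  rw [sum_sum_mul_kernel hP hW] at key
  simp_rw [← Finset.mul_sum, sum_outputLaw hP hW, mul_one, hP.2] at key
  linarith

/-- The mutual information is convex in the kernel. -/
theorem mutualInfo_convexComb_le {P : A → ℝ} (hP : ∀ a, 0 ≤ P a) {W W' : A → B → ℝ}
    (hW : IsKernel W) (hW' : IsKernel W') {ε : ℝ} (h0 : 0 < ε) (h1 : ε < 1) :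
    mutualInfo P (fun a b => (1 - ε) * W a b + ε * W' a b) ≤
      (1 - ε) * mutualInfo P W + ε * mutualInfo P W' := by
  have hV := hW.convexComb hW' h0.le h1.le
  have e0 : 0 < 1 - ε := sub_pos.2 h1
  simp only [mutualInfo, Finset.mul_sum, ← Finset.sum_add_distrib]
  refine Finset.sum_le_sum fun a _ => Finset.sum_le_sum fun b _ => ?_
  rcases (hP a).eq_or_lt with h | h
  · simp [← h]
  have w0 := hW.nonneg a b
  have w0' := hW'.nonneg a b
  have z1 := eq_zero_of_outputLaw_eq_zero hP hW h (b := b)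
  have z2 := eq_zero_of_outputLaw_eq_zero hP hW' h (b := b)
  have z3 := eq_zero_of_outputLaw_eq_zero hP hV h (b := b)
  have q0 := outputLaw_nonneg hP hW b
  have q0' := outputLaw_nonneg hP hW' b
  have q0V := outputLaw_nonneg hP hV b
  have hq := outputLaw_convexComb P W W' ε b
  generalize outputLaw P (fun a b => (1 - ε) * W a b + ε * W' a b) b = qV at *
  generalize outputLaw P W b = q at *
  generalize outputLaw P W' b = q' at *
  generalize W a b = w at *
  generalize W' a b = w' at *
  rcases (add_nonneg (mul_nonneg e0.le w0) (mul_nonneg h0.le w0')).eq_or_lt with hz | hz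
  · have := mul_nonneg e0.le w0
    have := mul_nonneg h0.le w0'
    have hw : w = 0 := (mul_eq_zero.1 (by linarith : (1 - ε) * w = 0)).resolve_left e0.ne'
    have hw' : w' = 0 := (mul_eq_zero.1 (by linarith : ε * w' = 0)).resolve_left h0.ne'
    simp [hw, hw']
  · have hqV : 0 < qV := q0V.lt_of_ne fun hh => hz.ne' (z3 hh.symm)
    -- The same tangent parameter serves both kernels: it is the likelihood ratio of the mixture, so
    -- the linear corrections cancel after averaging.
    have hu : 0 < ((1 - ε) * w + ε * w') / qV := div_pos hz hqV
    have i1 := mul_le_mul_of_nonneg_left (mul_log_add_sub_le_mul_log_div w0 q0 hu z1) e0.le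
    have i2 := mul_le_mul_of_nonneg_left (mul_log_add_sub_le_mul_log_div w0' q0' hu z2) h0.le
    have i3 : ((1 - ε) * w + ε * w') / qV * ((1 - ε) * q + ε * q') = (1 - ε) * w + ε * w' := by
      rw [← hq]; field_simp
    have i4 : ((1 - ε) * w + ε * w') * Real.log (((1 - ε) * w + ε * w') / qV) ≤
        (1 - ε) * (w * Real.log (w / q)) + ε * (w' * Real.log (w' / q')) := by
      linarith
    have i5 := mul_le_mul_of_nonneg_left i4 h.le
    linarith

/-- Mutual information is at most the relative entropy with respect to any product law. -/
theorem mutualInfo_le_sum_log_div {P : A → ℝ} (hP : P ∈ stdSimplex ℝ A) {W : A → B → ℝ}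
    (hW : IsKernel W) {Q : B → ℝ} (hQ : Q ∈ stdSimplex ℝ B) (h : ∀ a b, Q b = 0 → W a b = 0) :
    mutualInfo P W ≤ ∑ a, ∑ b, P a * W a b * Real.log (W a b / Q b) := by
  have key : ∑ a, ∑ b, (P a * W a b * Real.log (W a b / outputLaw P W b) +
      (P a * W a b - P a * W a b / outputLaw P W b * Q b)) ≤
      ∑ a, ∑ b, P a * W a b * Real.log (W a b / Q b) := by
    refine Finset.sum_le_sum fun a _ => Finset.sum_le_sum fun b _ => ?_
    rcases (hP.1 a).eq_or_lt with ha | ha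
    · simp [← ha]
    rcases (hW.nonneg a b).eq_or_lt with hw | hw
    · simp [← hw]
    have hq : 0 < outputLaw P W b := (outputLaw_nonneg hP.1 hW b).lt_of_ne fun hh =>
      hw.ne' (eq_zero_of_outputLaw_eq_zero hP.1 hW ha hh.symm)
    have h1 := mul_le_mul_of_nonneg_left (mul_log_add_sub_le_mul_log_div hw.le (hQ.1 b)
      (div_pos hw hq) (h a b)) ha.le
    calc _ = P a * (W a b * Real.log (W a b / outputLaw P W b) + W a b -
          W a b / outputLaw P W b * Q b) := by ring
      _ ≤ _ := by linarith
  -- Only `≤`, since a letter outside the support of the output law contributes `0 / 0 * Q b = 0`.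
  have h2 : ∑ a, ∑ b, P a * W a b / outputLaw P W b * Q b ≤ 1 := by
    rw [Finset.sum_comm, ← hQ.2]
    refine Finset.sum_le_sum fun b _ => ?_
    rw [← Finset.sum_mul, ← Finset.sum_div]
    exact mul_le_of_le_one_left (hQ.1 b) (div_self_le_one (outputLaw P W b))
  simp only [Finset.sum_add_distrib, Finset.sum_sub_distrib] at key
  rw [sum_sum_mul_kernel hP hW] at key
  unfold mutualInfo
  linarith

/-! ### Slope of the rate-distortion function, Lagrangian and Kuhn-Tucker condition. -/

theorem rateDistortion_le_mutualInfo {P : A → ℝ} (hP : P ∈ stdSimplex ℝ A) {d : A → B → ℝ} {D : ℝ}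
    {W : A → B → ℝ} (hW : IsKernel W) (hD : expDistortion P d W ≤ D) :
    rateDistortion P d D ≤ mutualInfo P W := by
  refine csInf_le ⟨0, ?_⟩ ⟨W, hW, hD, rfl⟩
  rintro r ⟨V, hV, -, rfl⟩
  exact mutualInfo_nonneg hP hV

/-- Perturbations below are mixtures of weight `ε`, admissible only for `0 < ε < 1`, so the sign of
the derivative is read off from right-hand slopes. -/
theorem deriv_nonpos_of_nonpos_right {g : ℝ → ℝ} {g' : ℝ} (hg : HasDerivAt g g' 0) (h0 : g 0 = 0)
    (h : ∀ ε, 0 < ε → ε < 1 → g ε ≤ 0) : g' ≤ 0 := by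
  have h1 := hg.hasDerivWithinAt (s := Set.Ioi 0)
  rw [hasDerivWithinAt_iff_tendsto_slope' (by simp)] at h1
  refine le_of_tendsto h1 ?_
  filter_upwards [Ioo_mem_nhdsGT (zero_lt_one (α := ℝ))] with ε hε
  rw [slope_def_field, h0, sub_zero, sub_zero]
  exact div_nonpos_of_nonpos_of_nonneg (h ε hε.1 hε.2) hε.1.le

theorem IsOptimalTestChannel.deriv_nonpos {P : A → ℝ} (hP : P ∈ stdSimplex ℝ A) {d : A → B → ℝ}
    {D : ℝ} {W : A → B → ℝ} (hW : IsOptimalTestChannel P d D W)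
    (hR : DifferentiableAt ℝ (rateDistortion P d) D) : deriv (rateDistortion P d) D ≤ 0 := by
  have h1 : HasDerivAt (fun ε : ℝ => rateDistortion P d (D + ε) - rateDistortion P d D)
      (deriv (rateDistortion P d) D) 0 := by
    refine (HasDerivAt.comp_const_add D 0 ?_).sub_const _
    simpa using hR.hasDerivAt
  refine deriv_nonpos_of_nonpos_right h1 (by simp) fun ε h0 _ => ?_
  have := rateDistortion_le_mutualInfo hP (D := D + ε) hW.1 (by linarith [hW.2.1])
  linarith [hW.2.2]

/-- The optimal test channel minimizes the Lagrangian whose slope is that of `R`. -/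
theorem IsOptimalTestChannel.lagrangian_le {P : A → ℝ} (hP : P ∈ stdSimplex ℝ A) {d : A → B → ℝ}
    {D : ℝ} {W : A → B → ℝ} (hW : IsOptimalTestChannel P d D W)
    (hR : DifferentiableAt ℝ (rateDistortion P d) D) {V : A → B → ℝ} (hV : IsKernel V) :
    mutualInfo P W ≤
      mutualInfo P V + -deriv (rateDistortion P d) D * (expDistortion P d V - D) := by
  -- Mixing `W` with weight `ε` of `V` is feasible at level `D + ε (E_V d - D)`, and convexity
  -- bounds its rate. Hence this function is nonpositive on `(0, 1)`, and its slope at `0` is the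
  -- claim.
  have h1 : HasDerivAt (fun ε : ℝ => rateDistortion P d (D + ε * (expDistortion P d V - D)) -
      rateDistortion P d D - ε * (mutualInfo P V - mutualInfo P W))
      (deriv (rateDistortion P d) D * (expDistortion P d V - D) -
        (mutualInfo P V - mutualInfo P W)) 0 := by
    have hlin (c : ℝ) : HasDerivAt (fun ε : ℝ => ε * c) c 0 := by
      simpa using (hasDerivAt_id (0 : ℝ)).mul_const c
    refine (HasDerivAt.sub_const _ ?_).sub (hlin _)
    refine HasDerivAt.comp (h₂ := rateDistortion P d) 0 ?_ ((hlin _).const_add D)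
    simpa using hR.hasDerivAt
  have h2 := deriv_nonpos_of_nonpos_right h1 (by simp) fun ε h0 h1 => by
    have i1 := rateDistortion_le_mutualInfo hP
      (D := D + ε * (expDistortion P d V - D)) (d := d) (hW.1.convexComb hV h0.le h1.le) (by
        rw [expDistortion_convexComb]
        have := mul_le_mul_of_nonneg_left hW.2.1 (sub_nonneg.2 h1.le)
        linarith)
    have i2 := mutualInfo_convexComb_le hP.1 hW.1 hV h0 h1
    have i3 := hW.2.2
    rw [← i3]
    linarith
  linarith

/-- Any output law `Q` yields a kernel whose Lagrangian is at most `-E[log E_Q exp (λ D - λ d)]`. -/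
theorem exists_kernel_lagrangian_le {P : A → ℝ} (hP : P ∈ stdSimplex ℝ A) (d : A → B → ℝ)
    (D l : ℝ) {Q : B → ℝ} (hQ : Q ∈ stdSimplex ℝ B)
    (hZ : ∀ a, 0 < ∑ b, Q b * Real.exp (l * D - l * d a b)) :
    ∃ V : A → B → ℝ, IsKernel V ∧ mutualInfo P V + l * (expDistortion P d V - D) ≤
      -∑ a, P a * Real.log (∑ b, Q b * Real.exp (l * D - l * d a b)) := by
  set Z : A → ℝ := fun a => ∑ b, Q b * Real.exp (l * D - l * d a b) with hZdef
  replace hZ : ∀ a, 0 < Z a := hZ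
  -- The Gibbs kernel: `Q` reweighted by `exp (-l d)` and normalized.
  let V : A → B → ℝ := fun a b => Q b * Real.exp (l * D - l * d a b) / Z a
  have hV : IsKernel V := fun a =>
    ⟨fun b => div_nonneg (mul_nonneg (hQ.1 b) (Real.exp_pos _).le) (hZ a).le, by
      simp only [V]
      rw [← Finset.sum_div]
      exact div_self (hZ a).ne'⟩
  refine ⟨V, hV, ?_⟩
  have h1 := mutualInfo_le_sum_log_div hP hV hQ fun a b h => by simp [V, h]
  have h2 : ∑ a, ∑ b, P a * V a b * Real.log (V a b / Q b) =
      ∑ a, ∑ b, (P a * V a b * (l * D) - l * (P a * V a b * d a b) -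
        P a * V a b * Real.log (Z a)) := by
    refine Finset.sum_congr rfl fun a _ => Finset.sum_congr rfl fun b _ => ?_
    rcases (hQ.1 b).eq_or_lt with hq | hq
    · simp [V, ← hq]
    have : V a b / Q b = Real.exp (l * D - l * d a b) / Z a := by
      simp only [V]; field_simp
    rw [this, Real.log_div (Real.exp_pos _).ne' (hZ a).ne', Real.log_exp]
    ring
  have h3 : ∑ a, ∑ b, P a * V a b * Real.log (Z a) = ∑ a, P a * Real.log (Z a) := by
    refine Finset.sum_congr rfl fun a _ => ?_
    rw [← Finset.sum_mul, ← Finset.mul_sum, hV.sum_eq_one, mul_one]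
  have h4 : ∑ a, ∑ b, P a * V a b * (l * D) = l * D := by
    simp_rw [← Finset.sum_mul]
    rw [sum_sum_mul_kernel hP hV, one_mul]
  simp only [Finset.sum_sub_distrib, ← Finset.mul_sum] at h2
  rw [h3, h4] at h2
  have h5 : expDistortion P d V = ∑ a, ∑ b, P a * V a b * d a b := rfl
  rw [h2, ← h5] at h1
  linarith

/-- Gibbs variational inequality: the tangent-line bound against the weights `Q k`, with parameter
`1 / Z a`. It bounds from below the Lagrangian of `W` at its own output law. -/
theorem neg_sum_log_le_lagrangian {P : A → ℝ} (hP : P ∈ stdSimplex ℝ A) (d : A → B → ℝ)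
    (D l : ℝ) {W : A → B → ℝ} (hW : IsKernel W)
    (hZ : ∀ a, 0 < ∑ b, outputLaw P W b * Real.exp (l * D - l * d a b)) :
    -∑ a, P a * Real.log (∑ b, outputLaw P W b * Real.exp (l * D - l * d a b)) ≤
      mutualInfo P W + l * (expDistortion P d W - D) := by
  set Z : A → ℝ := fun a => ∑ b, outputLaw P W b * Real.exp (l * D - l * d a b) with hZdef
  replace hZ : ∀ a, 0 < Z a := hZ
  have h4 : ∑ a, ∑ b, P a * W a b * (l * D) = l * D := by
    simp_rw [← Finset.sum_mul]
    rw [sum_sum_mul_kernel hP hW, one_mul]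
  have h5 : mutualInfo P W + l * (expDistortion P d W - D) =
      ∑ a, ∑ b, (P a * W a b * Real.log (W a b / outputLaw P W b) +
        l * (P a * W a b * d a b) - P a * W a b * (l * D)) := by
    simp only [Finset.sum_sub_distrib, Finset.sum_add_distrib]
    rw [h4]
    simp only [← Finset.mul_sum, mutualInfo, expDistortion]
    ring
  rw [h5, ← Finset.sum_neg_distrib]
  refine Finset.sum_le_sum fun a _ => ?_
  rcases (hP.1 a).eq_or_lt with ha | ha
  · simp [← ha]
  have key : ∑ b, (P a * W a b * -Real.log (Z a) + P a * W a b -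
      P a * (outputLaw P W b * Real.exp (l * D - l * d a b) / Z a)) ≤
      ∑ b, (P a * W a b * Real.log (W a b / outputLaw P W b) +
        l * (P a * W a b * d a b) - P a * W a b * (l * D)) := by
    refine Finset.sum_le_sum fun b _ => ?_
    have hq := outputLaw_nonneg hP.1 hW b
    have hz := eq_zero_of_outputLaw_eq_zero hP.1 hW ha (b := b)
    have h1 := mul_le_mul_of_nonneg_left (mul_log_add_sub_le_mul_log_div (hW.nonneg a b)
      (mul_nonneg hq (Real.exp_pos (l * D - l * d a b)).le) (inv_pos.2 (hZ a))
      fun h => hz ((mul_eq_zero.1 h).resolve_right (Real.exp_pos _).ne')) ha.le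
    rw [Real.log_inv] at h1
    rcases (hW.nonneg a b).eq_or_lt with hw | hw
    · rw [← hw] at h1 ⊢
      simp only [zero_mul, mul_zero, add_zero, sub_zero, zero_sub] at h1 ⊢
      rw [div_eq_inv_mul]
      linarith
    have hq' : 0 < outputLaw P W b := hq.lt_of_ne fun hh => hw.ne' (hz hh.symm)
    rw [← div_div, Real.log_div (by positivity) (Real.exp_pos _).ne', Real.log_exp] at h1
    rw [div_eq_inv_mul]
    linarith
  refine le_trans (le_of_eq ?_) key
  rw [Finset.sum_sub_distrib, Finset.sum_add_distrib, ← Finset.sum_mul, ← Finset.mul_sum,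
    ← Finset.mul_sum, ← Finset.sum_div, hW.sum_eq_one]
  have : (∑ b, outputLaw P W b * Real.exp (l * D - l * d a b)) / Z a = 1 := div_self (hZ a).ne'
  rw [this]
  ring

theorem sum_mul_exp_pos {Q : B → ℝ} (hQ : Q ∈ stdSimplex ℝ B) (f : B → ℝ) :
    0 < ∑ b, Q b * Real.exp (f b) := by
  refine (Finset.sum_nonneg fun b _ => mul_nonneg (hQ.1 b) (Real.exp_pos _).le).lt_of_ne fun h => ?_
  have h1 := (Finset.sum_eq_zero_iff_of_nonneg
    (fun b _ => mul_nonneg (hQ.1 b) (Real.exp_pos _).le)).1 h.symm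
  have h2 : ∑ b, Q b = 0 := Finset.sum_eq_zero fun b hb =>
    (mul_eq_zero.1 (h1 b hb)).resolve_right (Real.exp_pos _).ne'
  rw [hQ.2] at h2
  exact one_ne_zero h2

theorem outputLaw_mem_stdSimplex {P : A → ℝ} (hP : P ∈ stdSimplex ℝ A) {W : A → B → ℝ}
    (hW : IsKernel W) : outputLaw P W ∈ stdSimplex ℝ B :=
  ⟨outputLaw_nonneg hP.1 hW, sum_outputLaw hP hW⟩

/-- The Kuhn-Tucker condition for the optimal output law, at every reproduction letter. -/
theorem IsOptimalTestChannel.sum_div_le_one {P : A → ℝ} (hP : P ∈ stdSimplex ℝ A)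
    {d : A → B → ℝ} {D : ℝ} {W : A → B → ℝ} (hW : IsOptimalTestChannel P d D W)
    (hR : DifferentiableAt ℝ (rateDistortion P d) D) {l : ℝ}
    (hl : l = -deriv (rateDistortion P d) D) (b₀ : B) :
    ∑ a, P a * (Real.exp (l * D - l * d a b₀) /
      ∑ b, outputLaw P W b * Real.exp (l * D - l * d a b)) ≤ 1 := by
  classical
  have hQ := outputLaw_mem_stdSimplex hP hW.1
  have hl0 : 0 ≤ l := by rw [hl]; exact neg_nonneg.2 (hW.deriv_nonpos hP hR)
  set k : A → B → ℝ := fun a b => Real.exp (l * D - l * d a b) with hk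
  set Z : A → ℝ := fun a => ∑ b, outputLaw P W b * k a b with hZdef
  have hZ : ∀ a, 0 < Z a := fun a => sum_mul_exp_pos hQ _
  have hkpos : ∀ a b, 0 < k a b := fun a b => Real.exp_pos _
  -- Writing `Z_ε` for the partition function after the shift of mass, `-E log Z ≤ L(W) ≤ I(W) ≤
  -- L(V) ≤ -E log Z_ε`, and `Z_ε / Z = 1 + ε (k / Z - 1)`. Complementary slackness is not needed:
  -- `l ≥ 0` gives `L(W) ≤ I(W)`.
  have h1 : ∀ ε : ℝ, 0 < ε → ε < 1 →
      ∑ a, P a * Real.log (1 + ε * (k a b₀ / Z a - 1)) ≤ 0 := by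
    intro ε h0 h1
    have hQ' : (fun b => (1 - ε) * outputLaw P W b + ε * (Pi.single b₀ 1 : B → ℝ) b) ∈
        stdSimplex ℝ B :=
      convex_stdSimplex ℝ B hQ (single_mem_stdSimplex ℝ b₀) (sub_nonneg.2 h1.le) h0.le (by ring)
    obtain ⟨V, hV, hVle⟩ := exists_kernel_lagrangian_le hP d D l hQ'
      fun a => sum_mul_exp_pos hQ' _
    have i1 := hW.lagrangian_le hP hR hV
    rw [← hl] at i1
    have i2 := neg_sum_log_le_lagrangian hP d D l hW.1 hZ
    have i3 : l * (expDistortion P d W - D) ≤ 0 :=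
      mul_nonpos_of_nonneg_of_nonpos hl0 (sub_nonpos.2 hW.2.1)
    have i4 : ∀ a, Real.log (∑ b, ((1 - ε) * outputLaw P W b +
        ε * (Pi.single b₀ 1 : B → ℝ) b) * Real.exp (l * D - l * d a b)) =
        Real.log (Z a) + Real.log (1 + ε * (k a b₀ / Z a - 1)) := by
      intro a
      have e1 : ∑ b, ((1 - ε) * outputLaw P W b +
          ε * (Pi.single b₀ 1 : B → ℝ) b) * Real.exp (l * D - l * d a b) =
          (1 - ε) * Z a + ε * k a b₀ := by
        simp only [add_mul, Finset.sum_add_distrib, mul_assoc, ← Finset.mul_sum]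
        congr 2
        simp [Pi.single_apply, hk]
      have e2 : 0 < 1 + ε * (k a b₀ / Z a - 1) := by
        have := mul_pos h0 (div_pos (hkpos a b₀) (hZ a))
        linarith
      rw [e1, ← Real.log_mul (hZ a).ne' e2.ne']
      congr 1
      have := (hZ a).ne'
      field_simp
      ring
    simp only [i4, mul_add, Finset.sum_add_distrib] at hVle
    have i5 : -∑ a, P a * Real.log (Z a) ≤ mutualInfo P W + l * (expDistortion P d W - D) := i2
    linarith
  have h2 : HasDerivAt (fun ε : ℝ => ∑ a, P a * Real.log (1 + ε * (k a b₀ / Z a - 1)))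
      (∑ a, P a * (k a b₀ / Z a - 1)) 0 := by
    refine HasDerivAt.fun_sum fun a _ => HasDerivAt.const_mul _ ?_
    have e1 : HasDerivAt (fun ε : ℝ => 1 + ε * (k a b₀ / Z a - 1)) (k a b₀ / Z a - 1) 0 := by
      simpa using ((hasDerivAt_id (0 : ℝ)).mul_const (k a b₀ / Z a - 1)).const_add 1
    simpa using e1.log (by simp)
  have h3 := deriv_nonpos_of_nonpos_right h2 (by simp) h1
  simp only [mul_sub, mul_one, Finset.sum_sub_distrib] at h3
  rw [hP.2] at h3
  linarith

/-- Here `exp j = 1 / Z`, and the numerator in the Kuhn-Tucker sum is at least `1` where `d ≤ D`,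
because `λ ≥ 0`. -/
theorem IsOptimalTestChannel.sum_exp_tiltedInfo_le_one {P : A → ℝ} (hP : P ∈ stdSimplex ℝ A)
    {d : A → B → ℝ} {D : ℝ} {W : A → B → ℝ} (hW : IsOptimalTestChannel P d D W)
    (hR : DifferentiableAt ℝ (rateDistortion P d) D) (b : B) :
    ∑ a, P a * (Real.exp (tiltedInfo P d D W a) * if d a b ≤ D then 1 else 0) ≤ 1 := by
  refine le_trans (Finset.sum_le_sum fun a _ => ?_) (hW.sum_div_le_one hP hR rfl b)
  refine mul_le_mul_of_nonneg_left ?_ (hP.1 a)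
  have hl0 := neg_nonneg.2 (hW.deriv_nonpos hP hR)
  have hZ := sum_mul_exp_pos (outputLaw_mem_stdSimplex hP hW.1) fun b =>
    -deriv (rateDistortion P d) D * D - -deriv (rateDistortion P d) D * d a b
  unfold tiltedInfo
  rw [Real.exp_log (one_div_pos.2 hZ)]
  split_ifs with h
  · rw [mul_one]
    refine div_le_div_of_nonneg_right (Real.one_le_exp ?_) hZ.le
    rw [sub_nonneg]
    exact mul_le_mul_of_nonneg_left h hl0
  · rw [mul_zero]
    exact div_nonneg (Real.exp_pos _).le hZ.le

end RateDistortion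

/-! ### Weak duality for codes. -/

section Duality

variable {S T₁ T₂ : Type*} [Fintype S] [Fintype T₁] [Fintype T₂] {M₁ M₂ : ℕ}
  {P : S → ℝ} {d₁ : S → T₁ → ℝ} {d₂ : S → T₂ → ℝ} {D₁ D₂ : ℝ}

theorem sum_le_sum_weighted {ι : Type*} [Fintype ι] {w f : ι → ℝ} {c : ℝ} (hw : w ∈ stdSimplex ℝ ι)
    (h : ∀ i, c ≤ f i) : c ≤ ∑ i, w i * f i := by
  calc c = ∑ i, w i * c := by rw [← Finset.sum_mul, hw.2, one_mul]
    _ ≤ _ := Finset.sum_le_sum fun i _ => mul_le_mul_of_nonneg_left (h i) (hw.1 i)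

theorem sum_mul_sum_comm {ι κ : Type*} [Fintype ι] [Fintype κ] (w : ι → ℝ) (f : ι → κ → ℝ) :
    ∑ i, w i * ∑ j, f i j = ∑ j, ∑ i, w i * f i j := by
  simp only [Finset.mul_sum]
  exact Finset.sum_comm

theorem sum_mul_sum_comm₂ {ι κ κ' : Type*} [Fintype ι] [Fintype κ] [Fintype κ'] (w : ι → ℝ)
    (f : ι → κ → κ' → ℝ) :
    ∑ i, w i * ∑ j, ∑ k, f i j k = ∑ j, ∑ k, ∑ i, w i * f i j k := by
  rw [sum_mul_sum_comm]
  exact Finset.sum_congr rfl fun j _ => sum_mul_sum_comm _ _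

/-- Weak duality: feasible dual values lower-bound the error of every randomized code. -/
theorem DualVars.Feasible.objective_le_excessProb {F : DualVars S T₁ T₂ M₁ M₂}
    (hF : F.Feasible P d₁ d₂ D₁ D₂) (c : RandCode S T₁ T₂ M₁ M₂) :
    F.objective ≤ c.excessProb P d₁ d₂ D₁ D₂ := by
  have k1 := c.qX₁_kernel
  have k2 := c.qX₂_kernel
  have k3 := c.qT₁_kernel
  have k4 := c.qT₂_kernel
  -- The averaging weights omit the channels and `y₁`, `y₂` are summed freely: the channel factors
  -- already sit on the right of `c4`.
  have hexcess : ∑ s, ∑ y₁, ∑ y₂, ∑ x₁, c.qX₁ s x₁ * ∑ x₂, c.qX₂ s x₂ *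
      ∑ t₁, c.qT₁ y₁ t₁ * ∑ t₂, c.qT₂ (y₁, y₂) t₂ *
        (F.lamA s x₂ y₁ y₂ t₁ t₂ + F.lamB s x₁ y₁ y₂ t₁ t₂ + F.lamC s x₁ x₂ y₁ y₂ t₁) ≤
      c.excessProb P d₁ d₂ D₁ D₂ := by
    have e : c.excessProb P d₁ d₂ D₁ D₂ =
        ∑ s, ∑ y₁, ∑ y₂, ∑ x₁, c.qX₁ s x₁ * ∑ x₂, c.qX₂ s x₂ *
          ∑ t₁, c.qT₁ y₁ t₁ * ∑ t₂, c.qT₂ (y₁, y₂) t₂ *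
          (P s * noiseless y₁ x₁ * noiseless y₂ x₂ * excessLoss d₁ d₂ D₁ D₂ s t₁ t₂) := by
      unfold RandCode.excessProb
      refine Finset.sum_congr rfl fun s _ => ?_
      simp only [Finset.mul_sum]
      calc _ = ∑ x₁, ∑ y₁, ∑ x₂, ∑ y₂, ∑ t₁, ∑ t₂, excessLoss d₁ d₂ D₁ D₂ s t₁ t₂ *
            (P s * c.qX₁ s x₁ * c.qX₂ s x₂ * noiseless y₁ x₁ * noiseless y₂ x₂ *
              c.qT₁ y₁ t₁ * c.qT₂ (y₁, y₂) t₂) :=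
            Finset.sum_congr rfl fun x₁ _ => Finset.sum_comm
        _ = ∑ x₁, ∑ y₁, ∑ y₂, ∑ x₂, ∑ t₁, ∑ t₂, excessLoss d₁ d₂ D₁ D₂ s t₁ t₂ *
            (P s * c.qX₁ s x₁ * c.qX₂ s x₂ * noiseless y₁ x₁ * noiseless y₂ x₂ *
              c.qT₁ y₁ t₁ * c.qT₂ (y₁, y₂) t₂) :=
            Finset.sum_congr rfl fun x₁ _ => Finset.sum_congr rfl fun y₁ _ => Finset.sum_comm
        _ = _ := by
            rw [Finset.sum_comm]
            refine Finset.sum_congr rfl fun y₁ _ => ?_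
            rw [Finset.sum_comm]
            refine Finset.sum_congr rfl fun y₂ _ => Finset.sum_congr rfl fun x₁ _ =>
              Finset.sum_congr rfl fun x₂ _ => Finset.sum_congr rfl fun t₁ _ =>
              Finset.sum_congr rfl fun t₂ _ => ?_
            ring
    rw [e]
    refine Finset.sum_le_sum fun s _ => Finset.sum_le_sum fun y₁ _ =>
      Finset.sum_le_sum fun y₂ _ => Finset.sum_le_sum fun x₁ _ =>
      mul_le_mul_of_nonneg_left (Finset.sum_le_sum fun x₂ _ =>
      mul_le_mul_of_nonneg_left (Finset.sum_le_sum fun t₁ _ =>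
      mul_le_mul_of_nonneg_left (Finset.sum_le_sum fun t₂ _ =>
      mul_le_mul_of_nonneg_left (hF.c4 s x₁ x₂ y₁ y₂ t₁ t₂) (k4.nonneg _ _))
      (k3.nonneg _ _)) (k2.nonneg _ _)) (k1.nonneg _ _)
  -- Each of the next three chains averages a constraint over those variables that its left side
  -- does not involve; kernels have total mass one, so the left side is unchanged.
  have hA : ∑ y₁, F.η₂ y₁ ≤ ∑ s, ∑ y₁, ∑ y₂, ∑ x₁, c.qX₁ s x₁ * ∑ x₂, c.qX₂ s x₂ *
      ∑ t₁, c.qT₁ y₁ t₁ * ∑ t₂, c.qT₂ (y₁, y₂) t₂ * F.lamA s x₂ y₁ y₂ t₁ t₂ := by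
    calc ∑ y₁, F.η₂ y₁ ≤ ∑ y₁, ∑ t₁, c.qT₁ y₁ t₁ * ∑ s, F.δ₃ s t₁ y₁ :=
          Finset.sum_le_sum fun y₁ _ => sum_le_sum_weighted (k3 y₁) fun t₁ =>
            sub_nonpos.1 (hF.c2 y₁ t₁)
      _ = ∑ s, ∑ y₁, ∑ t₁, c.qT₁ y₁ t₁ * F.δ₃ s t₁ y₁ := by
          rw [Finset.sum_comm (γ := S)]
          exact Finset.sum_congr rfl fun y₁ _ => sum_mul_sum_comm _ _
      _ ≤ ∑ s, ∑ y₁, ∑ x₂, c.qX₂ s x₂ * ∑ t₁, c.qT₁ y₁ t₁ * ∑ y₂, F.γ x₂ s t₁ y₁ y₂ :=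
          Finset.sum_le_sum fun s _ => Finset.sum_le_sum fun y₁ _ =>
            sum_le_sum_weighted (k2 s) fun x₂ => Finset.sum_le_sum fun t₁ _ =>
              mul_le_mul_of_nonneg_left (by linarith [hF.c8 s x₂ y₁ t₁]) (k3.nonneg _ _)
      _ = ∑ s, ∑ y₁, ∑ y₂, ∑ x₂, c.qX₂ s x₂ * ∑ t₁, c.qT₁ y₁ t₁ * F.γ x₂ s t₁ y₁ y₂ := by
          refine Finset.sum_congr rfl fun s _ => Finset.sum_congr rfl fun y₁ _ => ?_
          rw [← sum_mul_sum_comm]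
          exact Finset.sum_congr rfl fun x₂ _ => congrArg _ (sum_mul_sum_comm _ _)
      _ ≤ _ := Finset.sum_le_sum fun s _ => Finset.sum_le_sum fun y₁ _ =>
            Finset.sum_le_sum fun y₂ _ => sum_le_sum_weighted (k1 s) fun x₁ =>
            Finset.sum_le_sum fun x₂ _ => mul_le_mul_of_nonneg_left (Finset.sum_le_sum fun t₁ _ =>
            mul_le_mul_of_nonneg_left (sum_le_sum_weighted (k4 _) fun t₂ => by
              linarith [hF.c10 s x₂ y₁ y₂ t₁ t₂]) (k3.nonneg _ _)) (k2.nonneg _ _)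
  have hB : ∑ y₁, ∑ y₂, F.η₃ y₁ y₂ ≤ ∑ s, ∑ y₁, ∑ y₂, ∑ x₁, c.qX₁ s x₁ * ∑ x₂, c.qX₂ s x₂ *
      ∑ t₁, c.qT₁ y₁ t₁ * ∑ t₂, c.qT₂ (y₁, y₂) t₂ * F.lamB s x₁ y₁ y₂ t₁ t₂ := by
    calc ∑ y₁, ∑ y₂, F.η₃ y₁ y₂
        ≤ ∑ y₁, ∑ y₂, ∑ t₂, c.qT₂ (y₁, y₂) t₂ * ∑ s, F.δ₂ s t₂ y₁ y₂ :=
          Finset.sum_le_sum fun y₁ _ => Finset.sum_le_sum fun y₂ _ =>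
            sum_le_sum_weighted (k4 (y₁, y₂)) fun t₂ => sub_nonpos.1 (hF.c3 y₁ y₂ t₂)
      _ = ∑ s, ∑ y₁, ∑ y₂, ∑ t₂, c.qT₂ (y₁, y₂) t₂ * F.δ₂ s t₂ y₁ y₂ := by
          rw [Finset.sum_comm (γ := S)]
          refine Finset.sum_congr rfl fun y₁ _ => ?_
          rw [Finset.sum_comm (γ := S)]
          exact Finset.sum_congr rfl fun y₂ _ => sum_mul_sum_comm _ _
      _ ≤ _ := Finset.sum_le_sum fun s _ => Finset.sum_le_sum fun y₁ _ =>
            Finset.sum_le_sum fun y₂ _ => sum_le_sum_weighted (k1 s) fun x₁ =>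
            sum_le_sum_weighted (k2 s) fun x₂ => sum_le_sum_weighted (k3 y₁) fun t₁ =>
            Finset.sum_le_sum fun t₂ _ => mul_le_mul_of_nonneg_left (by
              linarith [hF.c7 s x₁ y₁ y₂ t₂, hF.c9 s x₁ y₁ y₂ t₁ t₂]) (k4.nonneg _ _)
  have hC : ∑ s, F.η₁ s ≤ ∑ s, ∑ y₁, ∑ y₂, ∑ x₁, c.qX₁ s x₁ * ∑ x₂, c.qX₂ s x₂ *
      ∑ t₁, c.qT₁ y₁ t₁ * ∑ t₂, c.qT₂ (y₁, y₂) t₂ * F.lamC s x₁ x₂ y₁ y₂ t₁ := by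
    refine Finset.sum_le_sum fun s _ => ?_
    calc F.η₁ s ≤ ∑ x₁, c.qX₁ s x₁ * ∑ x₂, c.qX₂ s x₂ * ∑ y₁, ∑ t₁, c.qT₁ y₁ t₁ *
          ∑ y₂, F.lamC s x₁ x₂ y₁ y₂ t₁ :=
          sum_le_sum_weighted (k1 s) fun x₁ => sum_le_sum_weighted (k2 s) fun x₂ => by
            have h1 := hF.c1 s x₂
            have h2 := hF.c6 s x₁ x₂
            have h3 : ∑ y₁, F.μ s x₁ x₂ y₁ ≤ ∑ y₁, ∑ t₁, c.qT₁ y₁ t₁ *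
                ∑ y₂, F.lamC s x₁ x₂ y₁ y₂ t₁ :=
              Finset.sum_le_sum fun y₁ _ => sum_le_sum_weighted (k3 y₁) fun t₁ => by
                linarith [hF.c5 s x₁ x₂ y₁ t₁]
            linarith
      _ = ∑ y₁, ∑ y₂, ∑ x₁, c.qX₁ s x₁ * ∑ x₂, c.qX₂ s x₂ *
          ∑ t₁, c.qT₁ y₁ t₁ * F.lamC s x₁ x₂ y₁ y₂ t₁ := by
          rw [← sum_mul_sum_comm₂]
          refine Finset.sum_congr rfl fun x₁ _ => congrArg _ ?_
          rw [← sum_mul_sum_comm₂]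
          refine Finset.sum_congr rfl fun x₂ _ => congrArg _ ?_
          exact Finset.sum_congr rfl fun y₁ _ => sum_mul_sum_comm _ _
      _ = _ := by
          refine Finset.sum_congr rfl fun y₁ _ => Finset.sum_congr rfl fun y₂ _ =>
            Finset.sum_congr rfl fun x₁ _ => congrArg _ <| Finset.sum_congr rfl fun x₂ _ =>
            congrArg _ <| Finset.sum_congr rfl fun t₁ _ => ?_
          rw [← Finset.sum_mul, k4.sum_eq_one, one_mul]
  simp only [mul_add, Finset.sum_add_distrib] at hexcess
  unfold DualVars.objective
  linarith

/-- The randomized code that uses the maps of a deterministic code. -/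
noncomputable def Code.toRandCode (c : Code S T₁ T₂ M₁ M₂) : RandCode S T₁ T₂ M₁ M₂ := by
  classical exact
  { qX₁ := fun s => Pi.single (c.f₁ s) 1
    qX₂ := fun s => Pi.single (c.f₂ s) 1
    qT₁ := fun y => Pi.single (c.g₁ y) 1
    qT₂ := fun y => Pi.single (c.g₂ y.1 y.2) 1
    qX₁_kernel := fun _ => single_mem_stdSimplex ℝ _
    qX₂_kernel := fun _ => single_mem_stdSimplex ℝ _
    qT₁_kernel := fun _ => single_mem_stdSimplex ℝ _
    qT₂_kernel := fun _ => single_mem_stdSimplex ℝ _ }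

theorem Code.excessProb_toRandCode (c : Code S T₁ T₂ M₁ M₂) :
    c.toRandCode.excessProb P d₁ d₂ D₁ D₂ = c.excessProb P d₁ d₂ D₁ D₂ := by
  classical
  unfold RandCode.excessProb Code.excessProb Code.toRandCode
  refine Finset.sum_congr rfl fun s _ => ?_
  simp [Pi.single_apply, noiseless, mul_comm]

theorem optDPSR_le_randCode (c : RandCode S T₁ T₂ M₁ M₂) :
    optDPSR M₁ M₂ P d₁ d₂ D₁ D₂ ≤ ((c.excessProb P d₁ d₂ D₁ D₂ : ℝ) : EReal) :=
  iSup₂_le fun _ hF => EReal.coe_le_coe_iff.2 (hF.objective_le_excessProb c)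

end Duality

/-! ### The explicit dual point. -/

section DualPoint

variable {S T₁ T₂ : Type*} [Fintype S]

theorem sum_noiseless {M : ℕ} (x : Fin M) : ∑ y, noiseless y x = 1 := by simp [noiseless]

/-- The dual point built from nonnegative weights `a`, `b` and a profile `v ≤ min 1 (a + b)`. -/
noncomputable def weightDualPoint (M₁ M₂ : ℕ) (P : S → ℝ) (d₁ : S → T₁ → ℝ) (d₂ : S → T₂ → ℝ)
    (D₁ D₂ : ℝ) (a b v : S → ℝ) (A B : ℝ) : DualVars S T₁ T₂ M₁ M₂ where
  η₁ s := P s * v s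
  η₂ _ := -A
  η₃ _ _ := -B
  η₄ _ := 0
  -- The factor `noiseless y₂ x₂` makes the sum over `y₂` in `c8` count the penalty once instead of
  -- `M₂` times. No such sum occurs between `δ₂` and `lamB`.
  lamA s x₂ _ y₂ t₁ _ := -(P s * (a s * if d₁ s t₁ ≤ D₁ then 1 else 0)) * noiseless y₂ x₂
  lamB s _ _ _ _ t₂ := -(P s * (b s * if d₂ s t₂ ≤ D₂ then 1 else 0))
  lamC s x₁ x₂ y₁ y₂ _ := P s * v s * noiseless y₁ x₁ * noiseless y₂ x₂
  μ s x₁ _ y₁ := P s * v s * noiseless y₁ x₁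
  δ₁ _ s := P s * v s
  δ₂ s t₂ _ _ := -(P s * (b s * if d₂ s t₂ ≤ D₂ then 1 else 0))
  δ₃ s t₁ _ := -(P s * (a s * if d₁ s t₁ ≤ D₁ then 1 else 0))
  θ _ s _ t₂ _ := -(P s * (b s * if d₂ s t₂ ≤ D₂ then 1 else 0))
  γ x₂ s t₁ _ y₂ := -(P s * (a s * if d₁ s t₁ ≤ D₁ then 1 else 0)) * noiseless y₂ x₂

theorem weightDualPoint_objective (M₁ M₂ : ℕ) (P : S → ℝ) (d₁ : S → T₁ → ℝ) (d₂ : S → T₂ → ℝ)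
    (D₁ D₂ : ℝ) (a b v : S → ℝ) (A B : ℝ) :
    (weightDualPoint M₁ M₂ P d₁ d₂ D₁ D₂ a b v A B).objective =
      ∑ s, P s * v s - M₁ * A - M₁ * M₂ * B := by
  simp [DualVars.objective, weightDualPoint]
  ring

theorem weightDualPoint_feasible (M₁ M₂ : ℕ) {P : S → ℝ} (hP : ∀ s, 0 ≤ P s) {d₁ : S → T₁ → ℝ}
    {d₂ : S → T₂ → ℝ} {D₁ D₂ : ℝ} {a b v : S → ℝ} {A B : ℝ} (ha : ∀ s, 0 ≤ a s)
    (hb : ∀ s, 0 ≤ b s) (hv : ∀ s, v s ≤ 1) (hvab : ∀ s, v s ≤ a s + b s)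
    (hA : ∀ t₁, ∑ s, P s * (a s * if d₁ s t₁ ≤ D₁ then 1 else 0) ≤ A)
    (hB : ∀ t₂, ∑ s, P s * (b s * if d₂ s t₂ ≤ D₂ then 1 else 0) ≤ B) :
    (weightDualPoint M₁ M₂ P d₁ d₂ D₁ D₂ a b v A B).Feasible P d₁ d₂ D₁ D₂ where
  c1 s x₂ := (sub_self _).le
  c2 y₁ t₁ := by
    simp only [weightDualPoint, Finset.sum_neg_distrib]
    linarith [hA t₁]
  c3 y₁ y₂ t₂ := by
    simp only [weightDualPoint, Finset.sum_neg_distrib]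
    linarith [hB t₂]
  c4 s x₁ x₂ y₁ y₂ t₁ t₂ := by
    simp only [weightDualPoint]
    have h1 : v s ≤ a s * (if d₁ s t₁ ≤ D₁ then 1 else 0) +
        b s * (if d₂ s t₂ ≤ D₂ then 1 else 0) + excessLoss d₁ d₂ D₁ D₂ s t₁ t₂ := by
      unfold excessLoss
      have := ha s
      have := hb s
      have := hv s
      have := hvab s
      simp only [← not_le]
      by_cases g₁ : d₁ s t₁ ≤ D₁ <;> by_cases g₂ : d₂ s t₂ ≤ D₂ <;> simp [g₁, g₂] <;> linarith
    have ha' : 0 ≤ a s * (if d₁ s t₁ ≤ D₁ then 1 else 0) :=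
      mul_nonneg (ha s) (by split_ifs <;> norm_num)
    have hb' : 0 ≤ b s * (if d₂ s t₂ ≤ D₂ then 1 else 0) :=
      mul_nonneg (hb s) (by split_ifs <;> norm_num)
    generalize a s * (if d₁ s t₁ ≤ D₁ then 1 else 0) = α at *
    generalize b s * (if d₂ s t₂ ≤ D₂ then 1 else 0) = β at *
    have hPα := mul_nonneg (hP s) ha'
    have hPβ := mul_nonneg (hP s) hb'
    have h2 := mul_le_mul_of_nonneg_left h1 (hP s)
    unfold noiseless
    -- On the diagonal this is `h2`. Off it the loss and `lamC` vanish, and the penalties have the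
    -- right sign.
    split_ifs <;> linarith
  c5 s x₁ x₂ y₁ t₁ := by
    simp only [weightDualPoint, ← Finset.mul_sum, sum_noiseless]
    linarith
  c6 s x₁ x₂ := by
    simp only [weightDualPoint, ← Finset.mul_sum, sum_noiseless]
    linarith
  c7 s x₁ y₁ y₂ t₂ := (neg_add_cancel _).le
  c8 s x₂ y₁ t₁ := by
    simp only [weightDualPoint, ← Finset.mul_sum, sum_noiseless]
    linarith
  c9 s x₁ y₁ y₂ t₁ t₂ := (neg_add_cancel _).le
  c10 s x₂ y₁ y₂ t₁ t₂ := (neg_add_cancel _).le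
  c11 s := le_rfl

theorem improvement_nonneg (M₁ M₂ : ℕ) {P : S → ℝ} (hP : ∀ s, 0 ≤ P s) (j₁ j₂ : S → ℝ)
    (γ₁ γ₂ : ℝ) : 0 ≤ improvement M₁ M₂ P j₁ j₂ γ₁ γ₂ := by
  refine Finset.sum_nonneg fun s _ => mul_nonneg (div_nonneg (hP s) (by positivity))
    (mul_nonneg (by positivity) ?_)
  split_ifs <;> norm_num

theorem sum_scaled_le {P : S → ℝ} {j χ : S → ℝ} {c γ : ℝ} (hc : 0 ≤ c)
    (h : ∑ s, P s * (Real.exp (j s) * χ s) ≤ 1) :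
    ∑ s, P s * (Real.exp (j s - γ) / c * χ s) ≤ Real.exp (-γ) / c := by
  calc ∑ s, P s * (Real.exp (j s - γ) / c * χ s)
      = Real.exp (-γ) / c * ∑ s, P s * (Real.exp (j s) * χ s) := by
        rw [Finset.mul_sum]
        refine Finset.sum_congr rfl fun s _ => ?_
        rw [sub_eq_add_neg, Real.exp_add]
        ring
    _ ≤ _ := mul_le_of_le_one_right (by positivity) h

theorem one_le_exp_sub_div_iff {j γ c : ℝ} (hc : 0 < c) :
    1 ≤ Real.exp (j - γ) / c ↔ Real.log c + γ ≤ j := by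
  rw [one_le_div hc, ← Real.log_le_iff_le_exp hc, le_sub_iff_add_le]

/-- Tilted-information type bounds with the additional term are attained by feasible dual points. -/
theorem exists_feasible_objective_eq {M₁ M₂ : ℕ} (hM₁ : 0 < M₁) (hM₂ : 0 < M₂) {P : S → ℝ}
    (hP : ∀ s, 0 ≤ P s) {d₁ : S → T₁ → ℝ} {d₂ : S → T₂ → ℝ} {D₁ D₂ : ℝ} {j₁ j₂ : S → ℝ}
    (h₁ : ∀ t, ∑ s, P s * (Real.exp (j₁ s) * if d₁ s t ≤ D₁ then 1 else 0) ≤ 1)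
    (h₂ : ∀ t, ∑ s, P s * (Real.exp (j₂ s) * if d₂ s t ≤ D₂ then 1 else 0) ≤ 1) (γ₁ γ₂ : ℝ) :
    ∃ F : DualVars S T₁ T₂ M₁ M₂, F.Feasible P d₁ d₂ D₁ D₂ ∧
      F.objective = baseBound M₁ M₂ P j₁ j₂ γ₁ γ₂ + improvement M₁ M₂ P j₁ j₂ γ₁ γ₂ := by
  have m₁ : (0 : ℝ) < M₁ := Nat.cast_pos.2 hM₁
  have m₂ : (0 : ℝ) < M₂ := Nat.cast_pos.2 hM₂
  have m₁₂ : (0 : ℝ) < M₁ * M₂ := mul_pos m₁ m₂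
  let a : S → ℝ := fun s => Real.exp (j₁ s - γ₁) / M₁
  let b : S → ℝ := fun s => Real.exp (j₂ s - γ₂) / (M₁ * M₂)
  have ha : ∀ s, 0 < a s := fun s => div_pos (Real.exp_pos _) m₁
  have hb : ∀ s, 0 < b s := fun s => div_pos (Real.exp_pos _) m₁₂
  have ha1 : ∀ s, 1 ≤ a s ↔ Real.log M₁ + γ₁ ≤ j₁ s := fun s => one_le_exp_sub_div_iff m₁
  have hb1 : ∀ s, 1 ≤ b s ↔ Real.log (M₁ * M₂) + γ₂ ≤ j₂ s := fun s => one_le_exp_sub_div_iff m₁₂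
  -- Where `a, b < 1` the mean `(a + b) / 2` is at most `1` and at most `a + b`; it is the source of
  -- the factor `1 / 2` in `improvement`.
  let v : S → ℝ := fun s =>
    if Real.log M₁ + γ₁ ≤ j₁ s ∨ Real.log (M₁ * M₂) + γ₂ ≤ j₂ s then 1 else (a s + b s) / 2
  refine ⟨weightDualPoint M₁ M₂ P d₁ d₂ D₁ D₂ a b v (Real.exp (-γ₁) / M₁)
    (Real.exp (-γ₂) / (M₁ * M₂)), weightDualPoint_feasible M₁ M₂ hP (fun s => (ha s).le)
    (fun s => (hb s).le) (fun s => ?_) (fun s => ?_) (fun t => sum_scaled_le m₁.le (h₁ t))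
    (fun t => sum_scaled_le m₁₂.le (h₂ t)), ?_⟩
  · simp only [v]
    split_ifs with h
    · exact le_rfl
    · rw [← ha1, ← hb1] at h
      push Not at h
      linarith
  · simp only [v]
    have := ha s
    have := hb s
    split_ifs with h
    · rw [← ha1, ← hb1] at h
      rcases h with h | h <;> linarith
    · linarith
  · have hv : ∑ s, P s * v s =
        (∑ s, if Real.log M₁ + γ₁ ≤ j₁ s ∨ Real.log (M₁ * M₂) + γ₂ ≤ j₂ s then P s else 0) +
          improvement M₁ M₂ P j₁ j₂ γ₁ γ₂ := by
      rw [improvement, ← Finset.sum_add_distrib]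
      refine Finset.sum_congr rfl fun s _ => ?_
      simp only [v, ← not_le, ← not_or]
      split_ifs with h
      · ring
      · simp only [a, b]
        field_simp
        ring
    rw [weightDualPoint_objective, hv, baseBound, mul_div_cancel₀ _ m₁.ne',
      mul_div_cancel₀ _ m₁₂.ne']
    ring

end DualPoint

end SuccRef

theorem mainTheorem6 {S T₁ T₂ : Type*} [Fintype S] [Fintype T₁] [Fintype T₂]
    (M₁ M₂ : ℕ) (hM₁ : 0 < M₁) (hM₂ : 0 < M₂)
    (P : S → ℝ) (hP : P ∈ stdSimplex ℝ S)
    (d₁ : S → T₁ → ℝ) (hd₁ : ∀ s t, 0 ≤ d₁ s t)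
    (d₂ : S → T₂ → ℝ) (hd₂ : ∀ s t, 0 ≤ d₂ s t)
    (D₁ D₂ : ℝ) (hD₁ : 0 ≤ D₁) (hD₂ : 0 ≤ D₂)
    (hSR : SuccRef.IsSuccessivelyRefinable P d₁ d₂ D₁ D₂)
    -- the tilted informations are defined: the infima are attained and the slopes exist
    (W₁ : S → T₁ → ℝ) (hW₁ : SuccRef.IsOptimalTestChannel P d₁ D₁ W₁)
    (hR₁ : DifferentiableAt ℝ (SuccRef.rateDistortion P d₁) D₁)
    (W₂ : S → T₂ → ℝ) (hW₂ : SuccRef.IsOptimalTestChannel P d₂ D₂ W₂)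
    (hR₂ : DifferentiableAt ℝ (SuccRef.rateDistortion P d₂) D₂)
    (j₁ : S → ℝ) (hj₁ : j₁ = SuccRef.tiltedInfo P d₁ D₁ W₁)
    (j₂ : S → ℝ) (hj₂ : j₂ = SuccRef.tiltedInfo P d₂ D₂ W₂) :
    -- the dual optimum is a lower bound for every code, deterministic or randomized
    (∀ c : SuccRef.Code S T₁ T₂ M₁ M₂,
      SuccRef.optDPSR M₁ M₂ P d₁ d₂ D₁ D₂ ≤ ((c.excessProb P d₁ d₂ D₁ D₂ : ℝ) : EReal)) ∧
    (∀ c : SuccRef.RandCode S T₁ T₂ M₁ M₂,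
      SuccRef.optDPSR M₁ M₂ P d₁ d₂ D₁ D₂ ≤ ((c.excessProb P d₁ d₂ D₁ D₂ : ℝ) : EReal)) ∧
    -- each member of the family of bounds is the value of a dual feasible point
    (∀ γ₁ γ₂ : ℝ, ∃ F : SuccRef.DualVars S T₁ T₂ M₁ M₂, F.Feasible P d₁ d₂ D₁ D₂ ∧
      F.objective = SuccRef.baseBound M₁ M₂ P j₁ j₂ γ₁ γ₂
        + SuccRef.improvement M₁ M₂ P j₁ j₂ γ₁ γ₂) ∧
    (⨆ (γ₁ : ℝ) (γ₂ : ℝ), ((SuccRef.baseBound M₁ M₂ P j₁ j₂ γ₁ γ₂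
        + SuccRef.improvement M₁ M₂ P j₁ j₂ γ₁ γ₂ : ℝ) : EReal))
      ≤ SuccRef.optDPSR M₁ M₂ P d₁ d₂ D₁ D₂ ∧
    -- the additional term is nonnegative
    (∀ γ₁ γ₂ : ℝ, 0 ≤ SuccRef.improvement M₁ M₂ P j₁ j₂ γ₁ γ₂) := by
  have hF := SuccRef.exists_feasible_objective_eq (M₁ := M₁) (M₂ := M₂) hM₁ hM₂ hP.1
    (fun t => hj₁ ▸ hW₁.sum_exp_tiltedInfo_le_one hP hR₁ t)
    (fun t => hj₂ ▸ hW₂.sum_exp_tiltedInfo_le_one hP hR₂ t)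
  refine ⟨fun c => ?_, SuccRef.optDPSR_le_randCode, hF, iSup₂_le fun γ₁ γ₂ => ?_,
    SuccRef.improvement_nonneg M₁ M₂ hP.1 j₁ j₂⟩
  · rw [← c.excessProb_toRandCode]
    exact SuccRef.optDPSR_le_randCode c.toRandCode
  · obtain ⟨F, hFeas, hobj⟩ := hF γ₁ γ₂
    rw [← hobj]
    exact le_iSup₂_of_le F hFeas le_rfl
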